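/- Let $K$ be a field of characteristic zero (for instance $K=\mathbb{C}$, or $K=\mathbb{Q}(b)$ with $b$ an indeterminate), let $b\in K$, and let $t$ be a positive integer. For an integer partition $\lambda$, write $|\lambda|$ for the sum of its parts. The hook length of a box $v$ of the Ferrers diagram of $\lambda$ is the number of boxes consisting of $v$ itself, the boxes to the right of $v$ in its row, and the boxes of its column that lie in rows of larger index (the rows being indexed by the parts of $\lambda$ in weakly decreasing order). Let $\mathcal{H}_t(\lambda)$ be the multiset of all hook lengths of boxes of $\lambda$ that are divisible by $t$. Then, as formal power series in $x$ over $K$, $$ \sum_{\lambda} x^{|\lambda|}\prod_{h\in\mathcal{H}_t(\lambda)}\frac{tb}{h^2} \;=\; e^{bx^t}\prod_{k\ge 1}\frac{(1-x^{tk})^t}{1-x^k}, $$ where $\lambda$ runs over all integer partitions, including the empty one, an empty product is $1$, and $e^{bx^t}=\sum_{n\ge 0} b^n x^{tn}/n!$. The infinite sum and the infinite product both converge unconditionally, coefficient by coefficient, with respect to any Hausdorff ring topology on $K$ (for instance the discrete topology). -/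

import Mathlib

/-- The hook length of the box `v` in the diagram `μ` (boxes are pairs `(row, column)`, and the rows
grow in the direction of increasing row index): the number of boxes `u` of `μ` that are equal to
`v`, or lie in the same column with a larger row index, or in the same row with a larger column
index. -/
def YoungDiagram.hookLength (μ : YoungDiagram) (v : ℕ × ℕ) : ℕ :=
  (μ.cells.filter fun u =>
    u = v ∨ (u.2 = v.2 ∧ v.1 < u.1) ∨ (u.1 = v.1 ∧ v.2 < u.2)).card

/-- The multiset of the hook lengths of all boxes. -/
def YoungDiagram.hookLengths (μ : YoungDiagram) : Multiset ℕ :=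
  μ.cells.val.map μ.hookLength

/-- The multiset of the hook lengths that are divisible by `t`. -/
def YoungDiagram.hookLengthsDvd (t : ℕ) (μ : YoungDiagram) : Multiset ℕ :=
  μ.hookLengths.filter fun h => t ∣ h

open scoped PowerSeries.WithPiTopology

/-! Encode a partition by its Maya diagram: beads at the integers `rowLen i - i - 1`, gaps at `j -
colLen j`. Boxes correspond to pairs of a bead and a smaller gap, and the hook length is their
difference (`hookLength_eq`). Splitting ℤ into residue classes modulo t turns a partition into t
Maya diagrams, that is, t partitions (the t-quotient) and t charges of sum zero (the t-core),
bijectively (`exists_quotientEquiv`). The hook lengths divisible by t are t times those of the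
quotient (`prod_hookLength`), and the size is that of the core plus t times that of the quotient (a
consequence of `two_mul_card`).

So a weight that is a product over the quotient has generating function R(x) S(x^t)^t, where S
belongs to one component and R counts t-cores (`exists_hasSum_core`). Trivial weights determine R:
P(x) = R(x) P(x^t)^t for the partition series P. As tb/(th)^2 = (b/t)/h^2, the required S is
e^{bx/t}, once the sum of ∏ h^{-2} over the partitions of n is known to be 1/n!.

For that identity (`sum_prod_hookLength_sq_inv`), 1/∏ h is up to sign D(l) = det(1/(l_i - j)!), with
l the shifted beads. For a partition of n, the D-values after lowering one entry of l sum to n D(l);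
after raising one entry they sum to D(l), if l has a zero entry. Hence (n+1) ∑ D² over size n+1 and
∑ D² over size n are both the sum of D(l) D(l') over neighbouring pairs, and induction applies. -/

lemma Fin.two_mul_sum_val (n : ℕ) : 2 * ∑ i : Fin n, ((i : ℕ) : ℤ) = n * (n - 1) := by
  rw [Fin.sum_univ_eq_sum_range (fun i : ℕ => (i : ℤ))]
  induction n with
  | zero => simp
  | succ n ih =>
    rw [Finset.sum_range_succ, mul_add, ih]
    push_cast
    ring

/-! ### Beads, gaps and hook lengths. -/

namespace YoungDiagram

/-- The position of the bead of the row `i` in the Maya diagram of charge zero. -/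
def bead (μ : YoungDiagram) (i : ℕ) : ℤ := μ.rowLen i - i - 1

/-- The position of the gap of the column `j` in the Maya diagram of charge zero. -/
def gap (μ : YoungDiagram) (j : ℕ) : ℤ := j - μ.colLen j

/-- The set of beads of the Maya diagram of `μ` with charge `c`. -/
def maya (μ : YoungDiagram) (c : ℤ) : Set ℤ := {x | ∃ i, μ.bead i + c = x}

/-- A box satisfies both `j < rowLen i` and `i < colLen j`, a non-box neither; adding the two
inequalities compares bead and gap, and shows that they never coincide. -/
lemma gap_lt_bead_iff (μ : YoungDiagram) (i j : ℕ) : μ.gap j < μ.bead i ↔ (i, j) ∈ μ := by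
  have h1 : (i, j) ∈ μ ↔ j < μ.rowLen i := mem_iff_lt_rowLen
  have h2 : (i, j) ∈ μ ↔ i < μ.colLen j := mem_iff_lt_colLen
  unfold gap bead
  by_cases h : (i, j) ∈ μ
  · have := h1.1 h
    have := h2.1 h
    simp only [h, iff_true]
    omega
  · have := mt h1.2 h
    have := mt h2.2 h
    simp only [h, iff_false]
    omega

lemma bead_ne_gap (μ : YoungDiagram) (i j : ℕ) : μ.bead i ≠ μ.gap j := by
  have h1 : (i, j) ∈ μ ↔ j < μ.rowLen i := mem_iff_lt_rowLen
  have h2 : (i, j) ∈ μ ↔ i < μ.colLen j := mem_iff_lt_colLen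
  unfold gap bead
  by_cases h : (i, j) ∈ μ
  · have := h1.1 h
    have := h2.1 h
    omega
  · have := mt h1.2 h
    have := mt h2.2 h
    omega

lemma bead_strictAnti (μ : YoungDiagram) : StrictAnti μ.bead := by
  intro i j h
  have := μ.rowLen_anti i j h.le
  unfold bead
  omega

lemma gap_strictMono (μ : YoungDiagram) : StrictMono μ.gap := by
  intro i j h
  have := μ.colLen_anti i j h.le
  unfold gap
  omega

lemma rowLen_eq_zero_iff (μ : YoungDiagram) (i : ℕ) : μ.rowLen i = 0 ↔ μ.colLen 0 ≤ i := by
  have h1 : (i, 0) ∈ μ ↔ 0 < μ.rowLen i := mem_iff_lt_rowLen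
  have h2 : (i, 0) ∈ μ ↔ i < μ.colLen 0 := mem_iff_lt_colLen
  rw [h1] at h2
  omega

/-- If `i` is the first row whose bead lies below `x`, then column `x + i` has length exactly `i`,
so its gap is `x`. -/
lemma exists_gap_of_not_bead (μ : YoungDiagram) (x : ℤ) (hx : ∀ i, μ.bead i ≠ x) :
    ∃ j, μ.gap j = x := by
  have hex : ∃ i, μ.bead i ≤ x := by
    refine ⟨μ.colLen 0 + x.natAbs, ?_⟩
    have := (μ.rowLen_eq_zero_iff (μ.colLen 0 + x.natAbs)).2 (by omega)
    unfold bead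
    omega
  classical
  obtain ⟨i, hi, hmin⟩ : ∃ i, μ.bead i ≤ x ∧ ∀ k < i, ¬ μ.bead k ≤ x :=
    ⟨Nat.find hex, Nat.find_spec hex, fun k hk => Nat.find_min hex hk⟩
  have hlt := lt_of_le_of_ne hi (hx i)
  have hlt' := hlt
  unfold bead at hlt'
  obtain ⟨j, hj⟩ : ∃ j : ℕ, (j : ℤ) = x + i := ⟨(x + i).toNat, by omega⟩
  refine ⟨j, ?_⟩
  have h1 : ¬ i < μ.colLen j := by
    rw [← mem_iff_lt_colLen, mem_iff_lt_rowLen]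
    omega
  have h2 : i ≤ μ.colLen j := by
    rcases Nat.eq_zero_or_pos i with h | h
    · omega
    · have h3 := hmin (i - 1) (by omega)
      unfold bead at h3
      have : i - 1 < μ.colLen j := by
        rw [← mem_iff_lt_colLen, mem_iff_lt_rowLen]
        omega
      omega
  unfold gap
  omega

lemma notMem_maya_iff (μ : YoungDiagram) (c x : ℤ) :
    x ∉ μ.maya c ↔ ∃ j, μ.gap j + c = x := by
  constructor
  · intro h
    obtain ⟨j, hj⟩ := μ.exists_gap_of_not_bead (x - c) fun i hi => h ⟨i, by omega⟩
    exact ⟨j, by omega⟩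
  · rintro ⟨j, hj⟩ ⟨i, hi⟩
    exact μ.bead_ne_gap i j (by omega)

lemma hookLength_eq (μ : YoungDiagram) {i j : ℕ} (h : (i, j) ∈ μ) :
    (μ.hookLength (i, j) : ℤ) = μ.bead i - μ.gap j := by
  have h1 := mem_iff_lt_rowLen.1 h
  have h2 := mem_iff_lt_colLen.1 h
  have key : (μ.cells.filter fun u : ℕ × ℕ =>
      u = (i, j) ∨ (u.2 = (i, j).2 ∧ (i, j).1 < u.1) ∨ (u.1 = (i, j).1 ∧ (i, j).2 < u.2)) =
      (Finset.Ico i (μ.colLen j)).image (fun k => (k, j)) ∪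
        (Finset.Ioo j (μ.rowLen i)).image (fun k => (i, k)) := by
    ext ⟨a, b⟩
    simp only [Finset.mem_filter, mem_cells, Prod.mk.injEq, Finset.mem_union, Finset.mem_image,
      Finset.mem_Ico, Finset.mem_Ioo]
    constructor
    · rintro ⟨hm, ⟨rfl, rfl⟩ | ⟨rfl, h'⟩ | ⟨rfl, h'⟩⟩
      · exact Or.inl ⟨a, ⟨le_rfl, h2⟩, rfl, rfl⟩
      · exact Or.inl ⟨a, ⟨h'.le, mem_iff_lt_colLen.1 hm⟩, rfl, rfl⟩
      · exact Or.inr ⟨b, ⟨h', mem_iff_lt_rowLen.1 hm⟩, rfl, rfl⟩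
    · rintro (⟨k, ⟨hk, hk'⟩, rfl, rfl⟩ | ⟨k, ⟨hk, hk'⟩, rfl, rfl⟩)
      · refine ⟨mem_iff_lt_colLen.2 hk', ?_⟩
        rcases hk.eq_or_lt with h | h
        · exact Or.inl ⟨h.symm, rfl⟩
        · exact Or.inr (Or.inl ⟨rfl, h⟩)
      · exact ⟨mem_iff_lt_rowLen.2 hk', Or.inr (Or.inr ⟨rfl, hk⟩)⟩
  unfold hookLength
  rw [key, Finset.card_union_of_disjoint, Finset.card_image_of_injective,
    Finset.card_image_of_injective, Nat.card_Ico, Nat.card_Ioo]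
  · unfold bead gap
    omega
  · intro a b h
    simpa using h
  · intro a b h
    simpa using h
  · rw [Finset.disjoint_left]
    simp only [Finset.mem_image, Finset.mem_Ioo]
    rintro _ ⟨k, _, rfl⟩ ⟨l, hl, hl'⟩
    simp only [Prod.mk.injEq] at hl'
    omega

lemma ext_rowLen {μ ν : YoungDiagram} (h : ∀ i, μ.rowLen i = ν.rowLen i) : μ = ν := by
  ext ⟨i, j⟩
  rw [mem_cells, mem_cells, mem_iff_lt_rowLen, mem_iff_lt_rowLen, h]

/-- Strictly monotone sequences with equal ranges are equal; the charge is then read off in a row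
beyond both diagrams. -/
lemma maya_injective {μ ν : YoungDiagram} {c d : ℤ} (h : μ.maya c = ν.maya d) :
    μ = ν ∧ c = d := by
  have h1 : StrictMono fun i => -(μ.bead i + c) := fun i j hij => by
    have := μ.bead_strictAnti hij
    simp only
    omega
  have h2 : StrictMono fun i => -(ν.bead i + d) := fun i j hij => by
    have := ν.bead_strictAnti hij
    simp only
    omega
  have h3 : (fun i => -(μ.bead i + c)) = fun i => -(ν.bead i + d) := by
    rw [← StrictMono.range_inj h1 h2]
    ext x
    have := Set.ext_iff.1 h (-x)
    simp only [maya, Set.mem_ofPred_eq] at this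
    simp only [Set.mem_range, neg_eq_iff_eq_neg]
    exact this
  have h4 : ∀ i, μ.bead i + c = ν.bead i + d := fun i => by
    have : -(μ.bead i + c) = -(ν.bead i + d) := congrFun h3 i
    omega
  have h5 : c = d := by
    have h6 := h4 (max (μ.colLen 0) (ν.colLen 0))
    have h7 := (μ.rowLen_eq_zero_iff _).2 (le_max_left (μ.colLen 0) (ν.colLen 0))
    have h8 := (ν.rowLen_eq_zero_iff _).2 (le_max_right (μ.colLen 0) (ν.colLen 0))
    unfold bead at h6
    omega
  refine ⟨ext_rowLen fun i => ?_, h5⟩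
  have := h4 i
  unfold bead at this
  omega

/-- An antitone sequence that vanishes from `k` on is the sequence of row lengths of a diagram. -/
lemma exists_rowLen_eq (r : ℕ → ℕ) (hr : Antitone r) (k : ℕ) (hk : r k = 0) :
    ∃ μ : YoungDiagram, ∀ i, μ.rowLen i = r i := by
  have hmem : ∀ p : ℕ × ℕ,
      p ∈ (Finset.range k ×ˢ Finset.range (r 0)).filter (fun p => p.2 < r p.1) ↔ p.2 < r p.1 := by
    intro p
    simp only [Finset.mem_filter, Finset.mem_product, Finset.mem_range, and_iff_right_iff_imp]
    intro h
    refine ⟨?_, h.trans_le (hr (Nat.zero_le _))⟩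
    by_contra h'
    have := hr (not_lt.1 h')
    omega
  let μ : YoungDiagram :=
    { cells := (Finset.range k ×ˢ Finset.range (r 0)).filter (fun p => p.2 < r p.1)
      isLowerSet := by
        intro p q hqp hp
        rw [Finset.mem_coe, hmem] at hp ⊢
        exact (hqp.2.trans_lt hp).trans_le (hr hqp.1) }
  refine ⟨μ, fun i => ?_⟩
  have h : ∀ j, j < μ.rowLen i ↔ j < r i := fun j => by
    rw [← mem_iff_lt_rowLen, ← mem_cells]
    exact hmem (i, j)
  have h1 := h (μ.rowLen i)
  have h2 := h (r i)
  omega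

end YoungDiagram

/-- A set of integers that contains all sufficiently small and no sufficiently large integers. -/
def IsMaya (A : Set ℤ) : Prop := (∃ N, ∀ x, N ≤ x → x ∉ A) ∧ ∃ M, ∀ x, x ≤ M → x ∈ A

/-! ### Maya diagrams of arbitrary charge, their energy and their inversions. -/

namespace YoungDiagram

lemma isMaya_maya (μ : YoungDiagram) (c : ℤ) : IsMaya (μ.maya c) := by
  refine ⟨⟨μ.rowLen 0 + c, ?_⟩, ⟨c - 1 - μ.colLen 0, ?_⟩⟩
  · rintro x hx ⟨i, rfl⟩
    have := μ.rowLen_anti 0 i (Nat.zero_le i)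
    unfold bead at hx
    omega
  · intro x hx
    refine ⟨(c - 1 - x).toNat, ?_⟩
    have := (μ.rowLen_eq_zero_iff (c - 1 - x).toNat).2 (by omega)
    unfold bead
    omega

lemma _root_.IsMaya.exists_eq_maya {A : Set ℤ} (hA : IsMaya A) :
    ∃ (μ : YoungDiagram) (c : ℤ), A = μ.maya c := by
  classical
  obtain ⟨⟨N, hN⟩, ⟨M, hM⟩⟩ := hA
  -- The beads are enumerated downwards from `N`: the `i`-th one is `N - Nat.nth p i`.
  let p : ℕ → Prop := fun n => N - n ∈ A
  obtain ⟨B, hB⟩ : ∃ B : ℕ, ∀ n, B ≤ n → p n :=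
    ⟨(N - M).toNat, fun n hn => hM _ (by omega)⟩
  have hinf : (Set.ofPred p).Infinite :=
    Set.infinite_of_forall_exists_gt fun a => ⟨max B (a + 1), hB _ (le_max_left _ _),
      lt_of_lt_of_le (Nat.lt_succ_self a) (le_max_right _ _)⟩
  have hmono : StrictMono (Nat.nth p) := Nat.nth_strictMono hinf
  have hcount : ∀ i, i ≤ Nat.count p (B + i) := by
    intro i
    induction i with
    | zero => exact Nat.zero_le _
    | succ i ih =>
      rw [← add_assoc, Nat.count_succ, if_pos (hB _ (Nat.le_add_right _ _))]
      omega
  have hle : ∀ i, Nat.nth p i ≤ B + i := fun i =>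
    calc Nat.nth p i ≤ Nat.nth p (Nat.count p (B + i)) := hmono.monotone (hcount i)
      _ = B + i := Nat.nth_count (hB _ (Nat.le_add_right _ _))
  have hge : ∀ i, i ≤ Nat.nth p i := fun _ => hmono.le_apply
  have hd : Monotone fun i => Nat.nth p i - i := monotone_nat_of_le_succ fun i => by
    have := hmono (Nat.lt_succ_self i)
    have := hge i
    simp only [Nat.succ_eq_add_one] at *
    omega
  -- `Nat.nth p i - i` counts the gaps passed before the `i`-th bead. It is monotone and bounded,
  -- and its deficit from the maximum, the number of gaps below that bead, is the length of row `i`.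
  obtain ⟨k, hk⟩ : ∃ k, ∀ i, Nat.nth p i - i ≤ Nat.nth p k - k := by
    have hfin : (Set.range fun i => Nat.nth p i - i).Finite :=
      (Set.finite_Iic B).subset (by
        rintro _ ⟨i, rfl⟩
        have := hle i
        simp only [Set.mem_Iic]
        omega)
    obtain ⟨_, ⟨k, rfl⟩, hk⟩ := hfin.exists_maximal (Set.range_nonempty _)
    refine ⟨k, fun i => ?_⟩
    rcases le_total (Nat.nth p i - i) (Nat.nth p k - k) with h | h
    · exact h
    · exact hk ⟨i, rfl⟩ h
  obtain ⟨μ, hμ⟩ := exists_rowLen_eq (fun i => (Nat.nth p k - k) - (Nat.nth p i - i))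
    (fun i j hij => Nat.sub_le_sub_left (hd hij) _) k (Nat.sub_self _)
  refine ⟨μ, N + 1 - (Nat.nth p k - k : ℕ), ?_⟩
  have hbead : ∀ i, μ.bead i + (N + 1 - (Nat.nth p k - k : ℕ)) = N - Nat.nth p i := by
    intro i
    have := hk i
    have := hge i
    unfold bead
    rw [hμ]
    omega
  ext x
  simp only [maya, hbead, Set.mem_ofPred_eq]
  constructor
  · intro hx
    have hlt : x < N := lt_of_not_ge fun h => hN x h hx
    have hp : p (N - x).toNat := by
      change N - ((N - x).toNat : ℤ) ∈ A
      rwa [show N - ((N - x).toNat : ℤ) = x by omega]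
    refine ⟨Nat.count p (N - x).toNat, ?_⟩
    rw [Nat.nth_count hp]
    omega
  · rintro ⟨i, rfl⟩
    exact Nat.nth_mem_of_infinite hinf i

/-- The beads at positions at least `-N` are those of the first `N + c` rows. -/
lemma mem_maya_and_neg_le_iff (μ : YoungDiagram) {c N : ℤ} (h : μ.colLen 0 ≤ N + c) (x : ℤ) :
    x ∈ μ.maya c ∧ -N ≤ x ↔ ∃ i ∈ Finset.range (N + c).toNat, μ.bead i + c = x := by
  simp only [Finset.mem_range]
  constructor
  · rintro ⟨⟨i, rfl⟩, hi⟩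
    refine ⟨i, ?_, rfl⟩
    by_contra h'
    have := (μ.rowLen_eq_zero_iff i).2 (by omega)
    unfold bead at hi
    omega
  · rintro ⟨i, hi, rfl⟩
    refine ⟨⟨i, rfl⟩, ?_⟩
    unfold bead
    omega

lemma card_eq_sum_rowLen (μ : YoungDiagram) {n : ℕ} (h : μ.colLen 0 ≤ n) :
    μ.card = ∑ i ∈ Finset.range n, μ.rowLen i := by
  change μ.cells.card = _
  rw [Finset.card_eq_sum_card_fiberwise (f := Prod.fst) (t := Finset.range n)]
  · refine Finset.sum_congr rfl fun i _ => ?_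
    rw [rowLen_eq_card]
    rfl
  · rintro ⟨i, j⟩ hv
    have h1 := mem_iff_lt_rowLen.1 ((mem_cells _).1 (Finset.mem_coe.1 hv))
    have h2 := μ.rowLen_eq_zero_iff i
    simp only [Finset.coe_range, Set.mem_Iio]
    omega

/-- The energy formula: on a window containing all nonempty rows, the bead sum recovers the size up
to a polynomial in charge and window. The factor 2 avoids halves. -/
lemma two_mul_sum_bead (μ : YoungDiagram) {c N : ℤ} (h : μ.colLen 0 ≤ N + c) :
    2 * ∑ i ∈ Finset.range (N + c).toNat, (μ.bead i + c) =
      2 * μ.card + c ^ 2 - c - N ^ 2 - N := by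
  have hsum : ∀ n : ℕ, 2 * ∑ i ∈ Finset.range n, (c - i - 1) = n * (2 * c - n - 1) := by
    intro n
    induction n with
    | zero => simp
    | succ n ih =>
      rw [Finset.sum_range_succ, mul_add, ih]
      push_cast
      ring
  have h1 : ∑ i ∈ Finset.range (N + c).toNat, (μ.bead i + c) =
      ∑ i ∈ Finset.range (N + c).toNat, (μ.rowLen i : ℤ) +
        ∑ i ∈ Finset.range (N + c).toNat, (c - i - 1) := by
    rw [← Finset.sum_add_distrib]
    refine Finset.sum_congr rfl fun i _ => ?_
    unfold bead
    ring
  have h2 : ((N + c).toNat : ℤ) = N + c := by omega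
  rw [h1, mul_add, hsum, μ.card_eq_sum_rowLen (n := (N + c).toNat) (by omega), h2]
  push_cast
  ring

/-- The pairs consisting of a bead and a smaller gap. -/
def inversions (μ : YoungDiagram) (c : ℤ) : Finset (ℤ × ℤ) :=
  μ.cells.image fun v => (μ.bead v.1 + c, μ.gap v.2 + c)

lemma mem_inversions (μ : YoungDiagram) (c : ℤ) (p : ℤ × ℤ) :
    p ∈ μ.inversions c ↔ p.1 ∈ μ.maya c ∧ p.2 ∉ μ.maya c ∧ p.2 < p.1 := by
  rw [notMem_maya_iff]
  simp only [inversions, Finset.mem_image, mem_cells, maya, Set.mem_ofPred_eq]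
  constructor
  · rintro ⟨⟨i, j⟩, hv, rfl⟩
    have := (μ.gap_lt_bead_iff i j).2 hv
    exact ⟨⟨i, rfl⟩, ⟨j, rfl⟩, by simpa using this⟩
  · rintro ⟨⟨i, hi⟩, ⟨j, hj⟩, h⟩
    refine ⟨(i, j), (μ.gap_lt_bead_iff i j).1 (by omega), ?_⟩
    rw [hi, hj]

lemma prod_cells_eq_prod_inversions {M : Type*} [CommMonoid M] (μ : YoungDiagram) (c : ℤ)
    (f : ℕ → M) :
    ∏ v ∈ μ.cells, f (μ.hookLength v) = ∏ p ∈ μ.inversions c, f (p.1 - p.2).toNat := by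
  rw [inversions, Finset.prod_image]
  · refine Finset.prod_congr rfl ?_
    rintro ⟨i, j⟩ hv
    have := μ.hookLength_eq ((mem_cells _).1 hv)
    congr 1
    simp only
    omega
  · rintro ⟨i, j⟩ _ ⟨k, l⟩ _ h
    simp only [Prod.mk.injEq, add_left_inj] at h
    rw [μ.bead_strictAnti.injective h.1, μ.gap_strictMono.injective h.2]

end YoungDiagram

/-! ### Residue classes modulo t: cores and quotients. -/

lemma Int.exists_mul_add_fin {t : ℕ} (ht : 0 < t) (y : ℤ) :
    ∃ (r : Fin t) (x : ℤ), t * x + (r : ℕ) = y := by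
  have h0 : 0 ≤ y % t := Int.emod_nonneg y (by omega)
  have h1 : y % t < t := Int.emod_lt_of_pos y (by omega)
  refine ⟨⟨(y % t).toNat, by omega⟩, y / t, ?_⟩
  have := Int.mul_ediv_add_emod y t
  simp only
  omega

lemma Int.mul_add_fin_inj {t : ℕ} {r s : Fin t} {x y : ℤ}
    (h : (t : ℤ) * x + (r : ℕ) = t * y + (s : ℕ)) : r = s ∧ x = y := by
  have hr := r.2
  have hs := s.2
  have hxy : x = y := by
    rcases lt_trichotomy x y with h' | h' | h'
    · nlinarith
    · exact h'
    · nlinarith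
  subst hxy
  exact ⟨Fin.ext (by omega), rfl⟩

namespace YoungDiagram

/-- The Maya diagrams of `ν r` with charges `c r` are the residue classes modulo `t` of the Maya
diagram of `μ` with charge `d`. -/
def IsQuotient {t : ℕ} (μ : YoungDiagram) (d : ℤ) (ν : Fin t → YoungDiagram) (c : Fin t → ℤ) :
    Prop :=
  ∀ (r : Fin t) (x : ℤ), (t : ℤ) * x + (r : ℕ) ∈ μ.maya d ↔ x ∈ (ν r).maya (c r)

lemma exists_isQuotient {t : ℕ} (μ : YoungDiagram) (d : ℤ) :
    ∃ (ν : Fin t → YoungDiagram) (c : Fin t → ℤ), IsQuotient μ d ν c := by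
  obtain ⟨⟨N, hN⟩, ⟨M, hM⟩⟩ := μ.isMaya_maya d
  have h : ∀ r : Fin t, ∃ (ν : YoungDiagram) (c : ℤ),
      {x : ℤ | (t : ℤ) * x + (r : ℕ) ∈ μ.maya d} = ν.maya c := by
    intro r
    have hr : (r : ℤ) < t := by exact_mod_cast r.2
    -- The extra `-1` absorbs the residue `r < t`.
    refine IsMaya.exists_eq_maya ⟨⟨|N|, fun x hx => hN _ ?_⟩, ⟨-|M| - 1, fun x hx => hM _ ?_⟩⟩
    · nlinarith [le_abs_self N, abs_nonneg N]
    · nlinarith [neg_abs_le M, abs_nonneg M]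
  choose ν c h using h
  exact ⟨ν, c, fun r x => Set.ext_iff.1 (h r) x⟩

lemma exists_isQuotient_of_quotient {t : ℕ} (ht : 0 < t) (ν : Fin t → YoungDiagram)
    (c : Fin t → ℤ) : ∃ (μ : YoungDiagram) (d : ℤ), IsQuotient μ d ν c := by
  let A : Set ℤ := {y | ∃ (r : Fin t) (x : ℤ), x ∈ (ν r).maya (c r) ∧ (t : ℤ) * x + (r : ℕ) = y}
  have hA : ∀ (r : Fin t) (x : ℤ), (t : ℤ) * x + (r : ℕ) ∈ A ↔ x ∈ (ν r).maya (c r) := by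
    intro r x
    constructor
    · rintro ⟨s, y, hy, h⟩
      obtain ⟨rfl, rfl⟩ := Int.mul_add_fin_inj h
      exact hy
    · exact fun h => ⟨r, x, h, rfl⟩
  have hmaya := fun r => (ν r).isMaya_maya (c r)
  choose N hN using fun r => (hmaya r).1
  choose M hM using fun r => (hmaya r).2
  have hNB : ∀ r, |N r| ≤ ∑ s, |N s| := fun r =>
    Finset.single_le_sum (f := fun s => |N s|) (fun s _ => abs_nonneg _) (Finset.mem_univ r)
  have hMB : ∀ r, |M r| ≤ ∑ s, |M s| := fun r =>
    Finset.single_le_sum (f := fun s => |M s|) (fun s _ => abs_nonneg _) (Finset.mem_univ r)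
  have hmayaA : IsMaya A := by
    refine ⟨⟨t * (∑ s, |N s| + 1), fun y hy => ?_⟩, ⟨t * (-∑ s, |M s|), fun y hy => ?_⟩⟩
    · obtain ⟨r, x, rfl⟩ := Int.exists_mul_add_fin ht y
      rw [hA]
      refine hN r x ?_
      have hr : (r : ℤ) < t := by exact_mod_cast r.2
      have h1 := hNB r
      have h2 := le_abs_self (N r)
      have : ∑ s, |N s| < x := by
        by_contra h'
        nlinarith
      omega
    · obtain ⟨r, x, rfl⟩ := Int.exists_mul_add_fin ht y
      rw [hA]
      refine hM r x ?_
      have h1 := hMB r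
      have h2 := neg_abs_le (M r)
      have : x ≤ -∑ s, |M s| := by
        by_contra h'
        nlinarith
      omega
  obtain ⟨μ, d, h⟩ := hmayaA.exists_eq_maya
  exact ⟨μ, d, fun r x => by rw [← h, hA]⟩

namespace IsQuotient

variable {t : ℕ} {μ : YoungDiagram} {d : ℤ} {ν : Fin t → YoungDiagram} {c : Fin t → ℤ}

lemma unique_left (ht : 0 < t) (h : IsQuotient μ d ν c) {μ' : YoungDiagram} {d' : ℤ}
    (h' : IsQuotient μ' d' ν c) : μ = μ' ∧ d = d' := by
  refine maya_injective (Set.ext fun y => ?_)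
  obtain ⟨r, x, rfl⟩ := Int.exists_mul_add_fin ht y
  rw [h r x, h' r x]

lemma unique_right (h : IsQuotient μ d ν c) {ν' : Fin t → YoungDiagram} {c' : Fin t → ℤ}
    (h' : IsQuotient μ d ν' c') : ν = ν' ∧ c = c' := by
  have : ∀ r, ν r = ν' r ∧ c r = c' r := fun r =>
    maya_injective (Set.ext fun x => by rw [← h r x, ← h' r x])
  exact ⟨funext fun r => (this r).1, funext fun r => (this r).2⟩

/-- Since `t * x + r ≥ -t * N` exactly when `x ≥ -N`, one window cuts all residue classes at the
same height. Taking `f` constant compares charges, taking `f` the identity compares sizes. -/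
lemma sum_bead (ht : 0 < t) (h : IsQuotient μ d ν c) {N : ℤ} (hμ : μ.colLen 0 ≤ t * N + d)
    (hν : ∀ r, (ν r).colLen 0 ≤ N + c r) (f : ℤ → ℤ) :
    ∑ i ∈ Finset.range (t * N + d).toNat, f (μ.bead i + d) =
      ∑ r : Fin t, ∑ i ∈ Finset.range (N + c r).toNat,
        f (t * ((ν r).bead i + c r) + (r : ℕ)) := by
  rw [← Finset.sum_image (f := f) (g := fun i => μ.bead i + d), Finset.sum_sigma',
    ← Finset.sum_image (f := f)
      (g := fun p : Σ _ : Fin t, ℕ => t * ((ν p.1).bead p.2 + c p.1) + (p.1 : ℕ))]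
  · refine Finset.sum_congr (Finset.ext fun y => ?_) fun _ _ => rfl
    rw [Finset.mem_image, ← μ.mem_maya_and_neg_le_iff hμ]
    obtain ⟨r, x, rfl⟩ := Int.exists_mul_add_fin ht y
    have hr : (r : ℤ) < t := by exact_mod_cast r.2
    have hiff : -((t : ℤ) * N) ≤ t * x + (r : ℕ) ↔ -N ≤ x := by
      constructor
      · intro h'
        by_contra h''
        nlinarith
      · intro h'
        nlinarith
    rw [h r x, hiff, (ν r).mem_maya_and_neg_le_iff (hν r)]
    simp only [Finset.mem_image, Finset.mem_sigma, Finset.mem_univ, true_and, Sigma.exists]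
    constructor
    · rintro ⟨i, hi, rfl⟩
      exact ⟨r, i, hi, rfl⟩
    · rintro ⟨s, i, hi, he⟩
      obtain ⟨rfl, rfl⟩ := Int.mul_add_fin_inj he
      exact ⟨i, hi, rfl⟩
  · rintro ⟨r, i⟩ _ ⟨s, j⟩ _ he
    obtain ⟨rfl, he⟩ := Int.mul_add_fin_inj he
    have hij : i = j := (ν r).bead_strictAnti.injective (add_right_cancel he)
    subst hij
    rfl
  · intro i _ j _ he
    exact μ.bead_strictAnti.injective (add_right_cancel he)

lemma exists_window (ht : 0 < t) (μ : YoungDiagram) (d : ℤ) (ν : Fin t → YoungDiagram)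
    (c : Fin t → ℤ) :
    ∃ N : ℤ, (μ.colLen 0 : ℤ) ≤ t * N + d ∧ ∀ r, ((ν r).colLen 0 : ℤ) ≤ N + c r := by
  refine ⟨μ.colLen 0 + |d| + ∑ s, ((ν s).colLen 0 + |c s|), ?_, fun r => ?_⟩
  · have h1 : 0 ≤ ∑ s, (((ν s).colLen 0 : ℤ) + |c s|) :=
      Finset.sum_nonneg fun s _ => by positivity
    have h2 := neg_abs_le d
    nlinarith [abs_nonneg d]
  · have h1 : ((ν r).colLen 0 : ℤ) + |c r| ≤ ∑ s, (((ν s).colLen 0 : ℤ) + |c s|) :=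
      Finset.single_le_sum (f := fun s => ((ν s).colLen 0 : ℤ) + |c s|)
        (fun s _ => by positivity) (Finset.mem_univ r)
    have h2 := neg_abs_le (c r)
    have h3 := abs_nonneg d
    omega

lemma sum_charge (ht : 0 < t) (h : IsQuotient μ d ν c) : ∑ r, c r = d := by
  obtain ⟨N, hμ, hν⟩ := exists_window ht μ d ν c
  have := h.sum_bead ht hμ hν fun _ => 1
  simp only [Finset.sum_const, Finset.card_range, nsmul_eq_mul, mul_one] at this
  have h1 : ∀ r, ((N + c r).toNat : ℤ) = N + c r := fun r => by
    have := hν r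
    omega
  simp only [h1, Finset.sum_add_distrib, Finset.sum_const, Finset.card_univ, Fintype.card_fin,
    nsmul_eq_mul] at this
  omega

lemma two_mul_card (ht : 0 < t) (h : IsQuotient μ 0 ν c) :
    2 * (μ.card : ℤ) = 2 * (t * ∑ r, ((ν r).card : ℤ)) +
      ∑ r : Fin t, (t * (c r ^ 2 - c r) + 2 * (r : ℕ) * c r) := by
  obtain ⟨N, hμ, hν⟩ := exists_window ht μ 0 ν c
  have h1 : ∀ r, ((N + c r).toNat : ℤ) = N + c r := fun r => by
    have := hν r
    omega
  have h2 := congrArg (2 * ·) (h.sum_bead ht hμ hν id)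
  simp only [id_eq] at h2
  have h3 : ∀ r : Fin t, 2 * ∑ i ∈ Finset.range (N + c r).toNat,
      ((t : ℤ) * ((ν r).bead i + c r) + (r : ℕ)) =
      2 * (t * ((ν r).card : ℤ)) + (t * (c r ^ 2 - c r) + 2 * (r : ℕ) * c r) +
        (2 * N * (r : ℕ) - t * (N ^ 2 + N)) := by
    intro r
    rw [Finset.sum_add_distrib, ← Finset.mul_sum, mul_add, mul_left_comm,
      (ν r).two_mul_sum_bead (hν r), Finset.sum_const, Finset.card_range, nsmul_eq_mul, h1]
    ring
  rw [μ.two_mul_sum_bead hμ, Finset.mul_sum, Finset.sum_congr rfl fun r _ => h3 r,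
    Finset.sum_add_distrib, Finset.sum_add_distrib, ← Finset.mul_sum, ← Finset.mul_sum,
    Finset.sum_sub_distrib, Finset.sum_const, Finset.card_univ, Fintype.card_fin, nsmul_eq_mul,
    ← Finset.mul_sum] at h2
  have h4 : 2 * ∑ r : Fin t, ((r : ℕ) : ℤ) = t * (t - 1) :=
    Fin.two_mul_sum_val _
  have h5 : 2 * N * ∑ r : Fin t, ((r : ℕ) : ℤ) = N * (t * (t - 1)) := by
    rw [← h4]
    ring
  rw [h5] at h2
  linear_combination h2

/-- The difference of a bead and a gap is divisible by `t` exactly when both lie in one residue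
class; dividing by `t` gives an inversion of that quotient component. -/
lemma prod_hookLength (ht : 0 < t) (h : IsQuotient μ d ν c) {M : Type*} [CommMonoid M]
    (f : ℕ → M) :
    ∏ v ∈ μ.cells with t ∣ μ.hookLength v, f (μ.hookLength v) =
      ∏ r, ∏ v ∈ (ν r).cells, f (t * (ν r).hookLength v) := by
  rw [Finset.prod_filter,
    μ.prod_cells_eq_prod_inversions d (fun n => if t ∣ n then f n else 1), ← Finset.prod_filter]
  simp_rw [fun r => (ν r).prod_cells_eq_prod_inversions (c r) (fun n => f (t * n))]
  rw [Finset.prod_sigma']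
  symm
  refine Finset.prod_bij
    (fun p _ => ((t : ℤ) * p.2.1 + (p.1 : ℕ), (t : ℤ) * p.2.2 + (p.1 : ℕ))) ?_ ?_ ?_ ?_
  · rintro ⟨r, a, g⟩ hp
    simp only [Finset.mem_sigma, Finset.mem_univ, true_and, mem_inversions] at hp
    simp only [Finset.mem_filter, mem_inversions, h r]
    refine ⟨⟨hp.1, hp.2.1, by nlinarith⟩, ?_⟩
    rw [show (t : ℤ) * a + (r : ℕ) - (t * g + (r : ℕ)) = t * (a - g) by ring]
    rw [← Int.natCast_dvd_natCast, Int.toNat_of_nonneg (by nlinarith)]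
    exact dvd_mul_right _ _
  · rintro ⟨r, a, g⟩ _ ⟨s, a', g'⟩ _ he
    simp only [Prod.mk.injEq] at he
    obtain ⟨rfl, rfl⟩ := Int.mul_add_fin_inj he.1
    obtain ⟨_, rfl⟩ := Int.mul_add_fin_inj he.2
    rfl
  · rintro ⟨y, z⟩ hp
    simp only [Finset.mem_filter, mem_inversions] at hp
    obtain ⟨r, a, rfl⟩ := Int.exists_mul_add_fin ht y
    obtain ⟨s, g, rfl⟩ := Int.exists_mul_add_fin ht z
    obtain ⟨⟨h1, h2, h3⟩, h4⟩ := hp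
    have h5 : ∃ k : ℤ, (t : ℤ) * a + (r : ℕ) = t * k + (s : ℕ) := by
      rw [← Int.natCast_dvd_natCast, Int.toNat_of_nonneg (by omega)] at h4
      obtain ⟨k, hk⟩ := h4
      exact ⟨g + k, by linarith⟩
    obtain ⟨k, hk⟩ := h5
    obtain ⟨rfl, _⟩ := Int.mul_add_fin_inj hk
    refine ⟨⟨r, a, g⟩, ?_, rfl⟩
    simp only [Finset.mem_sigma, Finset.mem_univ, true_and, mem_inversions]
    exact ⟨(h r a).1 h1, mt (h r g).2 h2, by
      by_contra h'
      nlinarith⟩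
  · rintro ⟨r, a, g⟩ hp
    simp only [Finset.mem_sigma, Finset.mem_univ, true_and, mem_inversions] at hp
    obtain ⟨k, hk⟩ := Int.eq_ofNat_of_zero_le (show 0 ≤ a - g by omega)
    have h1 : (t : ℤ) * a + (r : ℕ) - (t * g + (r : ℕ)) = (t * k : ℕ) := by
      push_cast
      rw [← hk]
      ring
    simp only
    rw [h1, hk, Int.toNat_natCast, Int.toNat_natCast]

end IsQuotient

/-- A bijection between diagrams and pairs of a `t`-core, encoded by its charges, and a
`t`-quotient. -/
lemma exists_quotientEquiv {t : ℕ} (ht : 0 < t) :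
    ∃ (e : {c : Fin t → ℤ // ∑ r, c r = 0} × (Fin t → YoungDiagram) ≃ YoungDiagram),
      ∀ p, IsQuotient (e p) 0 p.2 p.1.1 := by
  have hex : ∀ p : {c : Fin t → ℤ // ∑ r, c r = 0} × (Fin t → YoungDiagram),
      ∃ μ : YoungDiagram, IsQuotient μ 0 p.2 p.1.1 := by
    intro p
    obtain ⟨μ, d, h⟩ := exists_isQuotient_of_quotient ht p.2 p.1.1
    have hd := h.sum_charge ht
    rw [p.1.2] at hd
    exact ⟨μ, by rwa [← hd] at h⟩
  choose φ hφ using hex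
  refine ⟨Equiv.ofBijective φ ⟨fun p q hpq => ?_, fun μ => ?_⟩, hφ⟩
  · have h1 := hφ p
    rw [hpq] at h1
    obtain ⟨h2, h3⟩ := h1.unique_right (hφ q)
    exact Prod.ext (Subtype.ext h3) h2
  · obtain ⟨ν, c, h⟩ := exists_isQuotient (t := t) μ 0
    have h1 := hφ (⟨c, h.sum_charge ht⟩, ν)
    exact ⟨(⟨c, h.sum_charge ht⟩, ν), (h1.unique_left ht h).1⟩

end YoungDiagram

/-- The reciprocal of the factorial, extended by zero to the negative integers. -/
def recipFactorial (K : Type*) [Field K] (n : ℤ) : K :=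
  if 0 ≤ n then ((n.toNat).factorial : K)⁻¹ else 0

/-! ### Reciprocal factorials. -/

section recipFactorial

variable {K : Type*} [Field K]

lemma recipFactorial_of_neg {n : ℤ} (hn : n < 0) : recipFactorial K n = 0 :=
  if_neg (not_le.2 hn)

lemma recipFactorial_natCast (n : ℕ) : recipFactorial K n = (n.factorial : K)⁻¹ := by
  simp [recipFactorial]

/-- The value zero at negative integers makes this hold at `n = 0` too, so no boundary cases arise
in the determinants. -/
lemma mul_recipFactorial [CharZero K] (n : ℤ) :
    (n : K) * recipFactorial K n = recipFactorial K (n - 1) := by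
  rcases lt_trichotomy n 0 with h | rfl | h
  · rw [recipFactorial_of_neg h, recipFactorial_of_neg (by omega), mul_zero]
  · rw [recipFactorial_of_neg (n := 0 - 1) (by omega)]
    simp
  · obtain ⟨k, rfl⟩ : ∃ k : ℕ, n = (k + 1 : ℕ) := ⟨(n - 1).toNat, by omega⟩
    rw [recipFactorial_natCast, show ((k + 1 : ℕ) : ℤ) - 1 = k by push_cast; ring,
      recipFactorial_natCast, Nat.factorial_succ]
    have h1 : (k.factorial : K) ≠ 0 := by exact_mod_cast k.factorial_ne_zero
    have h2 : ((k : K) + 1) ≠ 0 := by exact_mod_cast k.succ_ne_zero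
    push_cast
    field_simp

lemma recipFactorial_sub_natCast [CharZero K] (n j : ℕ) :
    recipFactorial K ((n : ℤ) - j) = (n.factorial : K)⁻¹ * n.descFactorial j := by
  rcases lt_or_ge n j with h | h
  · rw [recipFactorial_of_neg (by omega), Nat.descFactorial_eq_zero_iff_lt.2 h]
    simp
  · rw [show (n : ℤ) - j = (n - j : ℕ) by omega, recipFactorial_natCast,
      ← Nat.factorial_mul_descFactorial h]
    have h1 : ((n - j).factorial : K) ≠ 0 := by exact_mod_cast (n - j).factorial_ne_zero
    have h2 : (n.descFactorial j : K) ≠ 0 := by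
      exact_mod_cast fun h' => absurd (Nat.descFactorial_eq_zero_iff_lt.1 h') (not_lt.2 h)
    push_cast
    field_simp

end recipFactorial

/-! ### The derivative of the determinant. -/

namespace Matrix

/-- Jacobi's formula: both sides are the derivative of `det` at `M` in the direction `N`. -/
lemma sum_det_updateRow {n R : Type*} [Fintype n] [DecidableEq n] [CommRing R]
    (M N : Matrix n n R) :
    ∑ i, (M.updateRow i (N i)).det = (M.adjugate * N).trace := by
  have h : ∀ i, (M.updateRow i (N i)).det = (N * M.adjugate) i i := fun i => by
    rw [← cramer_transpose_apply, cramer_eq_adjugate_mulVec, ← adjugate_transpose, mulVec_transpose]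
    rfl
  rw [trace_mul_comm]
  exact Finset.sum_congr rfl fun i _ => h i

end Matrix

/-! ### Lowering and raising rules for det(1/(l_i - j)!). -/

section detRecip

open Matrix

variable (K : Type*) [Field K] {m : ℕ}

/-- The matrix of the numbers `1 / (l i - j)!`. -/
def recipMatrix (l : Fin m → ℤ) : Matrix (Fin m) (Fin m) K :=
  Matrix.of fun i j => recipFactorial K (l i - (j : ℕ))

/-- The determinant of the numbers `1 / (l i - j)!`. -/
def detRecip (l : Fin m → ℤ) : K := (recipMatrix K l).det

variable {K}

lemma recipMatrix_add_single (l : Fin m → ℤ) (i : Fin m) (a : ℤ) :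
    recipMatrix K (l + Pi.single i a) =
      (recipMatrix K l).updateRow i fun j => recipFactorial K (l i + a - (j : ℕ)) := by
  ext k j
  rcases eq_or_ne k i with rfl | h
  · simp [recipMatrix]
  · simp [recipMatrix, h]

lemma nonneg_of_detRecip_ne_zero {l : Fin m → ℤ} (h : detRecip K l ≠ 0) (i : Fin m) :
    0 ≤ l i := by
  by_contra hi
  refine h (Matrix.det_eq_zero_of_row_eq_zero i fun j => ?_)
  simp only [recipMatrix, Matrix.of_apply]
  exact recipFactorial_of_neg (by omega)

lemma injective_of_detRecip_ne_zero {l : Fin m → ℤ} (h : detRecip K l ≠ 0) :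
    Function.Injective l := by
  intro i j hij
  by_contra hne
  refine h (Matrix.det_zero_of_row_eq hne ?_)
  ext k
  simp [recipMatrix, hij]

/-- The lowered rows are those of `L * M - M * J`, with `L` and `J` the diagonal matrices of the `l
i` and of the column indices. In Jacobi's formula, cyclicity of the trace leaves `(tr L - tr J) *
det M`. -/
lemma sum_detRecip_sub_single [CharZero K] (l : Fin m → ℤ) :
    ∑ i, detRecip K (l + Pi.single i (-1)) =
      ((∑ i, l i - ∑ j : Fin m, ((j : ℕ) : ℤ) : ℤ) : K) * detRecip K l := by
  simp only [detRecip, recipMatrix_add_single]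
  have hrow : ∀ i : Fin m, (fun j : Fin m => recipFactorial K (l i + -1 - (j : ℕ))) =
      (Matrix.diagonal (fun i => (l i : K)) * recipMatrix K l -
        recipMatrix K l * Matrix.diagonal (fun j : Fin m => ((j : ℕ) : K))) i := by
    intro i
    ext j
    rw [show l i + -1 - (j : ℕ) = l i - (j : ℕ) - 1 by ring, ← mul_recipFactorial]
    simp only [Matrix.sub_apply, Matrix.diagonal_mul, Matrix.mul_diagonal, recipMatrix,
      Matrix.of_apply]
    push_cast
    ring
  simp only [hrow]
  rw [Matrix.sum_det_updateRow, mul_sub, Matrix.trace_sub, ← Matrix.mul_assoc,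
    Matrix.trace_mul_comm, ← Matrix.mul_assoc, ← Matrix.mul_assoc, Matrix.mul_adjugate,
    Matrix.adjugate_mul]
  simp only [Matrix.smul_mul, Matrix.one_mul, Matrix.trace_smul, Matrix.trace_diagonal,
    smul_eq_mul]
  push_cast
  ring

/-- Raising `l` shifts columns: column `j + 1` of `N` is column `j` of `M`, so only column 0
contributes to the trace in Jacobi's formula. Row `k` of `M` is (1, 0, …, 0), and 1/1! = 1/0!, so
replacing column 0 does not change the determinant. -/
lemma sum_detRecip_add_single {l : Fin m → ℤ} {k : Fin m} (hk : l k = 0) :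
    ∑ i, detRecip K (l + Pi.single i 1) = detRecip K l := by
  obtain _ | m := m
  · exact k.elim0
  simp only [detRecip, recipMatrix_add_single]
  set M := recipMatrix K l with hM
  let N : Matrix (Fin (m + 1)) (Fin (m + 1)) K :=
    Matrix.of fun i j => recipFactorial K (l i + 1 - (j : ℕ))
  have h1 : ∑ i, (M.updateRow i fun j => recipFactorial K (l i + 1 - (j : ℕ))).det =
      ∑ i, (M.updateRow i (N i)).det := rfl
  have hdiag : ∀ j : Fin m, (M.adjugate * N) j.succ j.succ = 0 := by
    intro j
    have h2 : (M.adjugate * N) j.succ j.succ = (M.adjugate * M) j.succ j.castSucc := by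
      rw [Matrix.mul_apply, Matrix.mul_apply]
      refine Finset.sum_congr rfl fun i _ => ?_
      congr 1
      simp only [N, hM, recipMatrix, Matrix.of_apply, Fin.val_succ, Fin.val_castSucc]
      congr 1
      push_cast
      ring
    rw [h2, Matrix.adjugate_mul, Matrix.smul_apply, Matrix.one_apply_ne, smul_zero]
    exact (Fin.castSucc_lt_succ).ne'
  rw [h1, Matrix.sum_det_updateRow, Matrix.trace, Fin.sum_univ_succ]
  simp only [Matrix.diag_apply, hdiag, Finset.sum_const_zero, add_zero]
  have h3 : (M.adjugate * N) 0 0 = (M.updateCol 0 fun i => N i 0).det := by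
    rw [← Matrix.cramer_apply, Matrix.cramer_eq_adjugate_mulVec]
    rfl
  have h4 : (M.updateCol 0 fun i => N i 0 - M i 0).det = 0 := by
    refine Matrix.det_eq_zero_of_row_eq_zero k fun j => ?_
    rcases eq_or_ne j 0 with rfl | hj
    · simp [N, hM, recipMatrix, hk, recipFactorial]
    · rw [Matrix.updateCol_ne hj]
      have := Fin.pos_iff_ne_zero.2 hj
      have : 0 < (j : ℕ) := this
      simp only [hM, recipMatrix, Matrix.of_apply, hk]
      exact recipFactorial_of_neg (by omega)
  have h5 : (fun i => N i 0) = (fun i => N i 0 - M i 0) + fun i => M i 0 := by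
    ext i
    simp
  rw [h3, h5, Matrix.det_updateCol_add, h4, zero_add]
  congr 1
  exact Matrix.updateCol_eq_self M 0

/-- After 1/l_i! is taken out of each row, the entries are monic polynomials of degree `j` in `l i`,
which leaves a Vandermonde determinant. -/
lemma detRecip_natCast [CharZero K] (l : Fin m → ℕ) :
    detRecip K (fun i => (l i : ℤ)) =
      (∏ i, ((l i).factorial : K))⁻¹ * ∏ i, ∏ j ∈ Finset.Ioi i, ((l j : K) - l i) := by
  have h : recipMatrix K (fun i => (l i : ℤ)) =
      Matrix.of fun i j => ((l i).factorial : K)⁻¹ *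
        (Matrix.of fun i j : Fin m => (descPochhammer K (j : ℕ)).eval (l i : K)) i j := by
    ext i j
    simp only [recipMatrix, Matrix.of_apply, recipFactorial_sub_natCast,
      descPochhammer_eval_eq_descFactorial]
  rw [detRecip, h, Matrix.det_mul_column, Finset.prod_inv_distrib, ← Matrix.det_vandermonde,
    Matrix.det_eval_matrixOfPolynomials_eq_det_vandermonde (fun i => (l i : K))
      (fun j : Fin m => descPochhammer K (j : ℕ)) (fun j => descPochhammer_natDegree K j)
      (fun j => monic_descPochhammer K j)]

end detRecip

/-! ### The recursion for sums of squared determinants. -/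

section strictTuples

open Classical in
/-- The strictly decreasing `m`-tuples of natural numbers with sum `n + (0 + ⋯ + (m - 1))`. -/
noncomputable def strictTuples (m n : ℕ) : Finset (Fin m → ℤ) :=
  (Fintype.piFinset fun _ => Finset.Icc 0 (n + ∑ j : Fin m, ((j : ℕ) : ℤ))).filter fun l =>
    StrictAnti l ∧ ∑ i, l i = n + ∑ j : Fin m, ((j : ℕ) : ℤ)

variable {m n : ℕ} {l : Fin m → ℤ}

lemma mem_strictTuples :
    l ∈ strictTuples m n ↔
      StrictAnti l ∧ (∀ i, 0 ≤ l i) ∧ ∑ i, l i = n + ∑ j : Fin m, ((j : ℕ) : ℤ) := by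
  simp only [strictTuples, Finset.mem_filter, Fintype.mem_piFinset, Finset.mem_Icc]
  constructor
  · exact fun ⟨h1, h2, h3⟩ => ⟨h2, fun i => (h1 i).1, h3⟩
  · rintro ⟨h1, h2, h3⟩
    refine ⟨fun i => ⟨h2 i, ?_⟩, h1, h3⟩
    rw [← h3]
    exact Finset.single_le_sum (fun j _ => h2 j) (Finset.mem_univ i)

lemma sum_add_single (l : Fin m → ℤ) (i : Fin m) (a : ℤ) :
    ∑ k, (l + Pi.single i a : Fin m → ℤ) k = ∑ k, l k + a := by
  simp [Finset.sum_add_distrib]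

lemma strictAnti_add_single_of_injective (hl : StrictAnti l) {i : Fin m} {a : ℤ}
    (ha : |a| ≤ 1) (h : Function.Injective (l + Pi.single i a)) :
    StrictAnti (l + Pi.single i a) := by
  intro j k hjk
  have h1 := hl hjk
  have h2 := h.ne hjk.ne
  have h3 := abs_le.1 ha
  refine lt_of_le_of_ne ?_ h2.symm
  simp only [Pi.add_apply, Pi.single_apply]
  split_ifs with hk hj hj
  · exact absurd (hj.trans hk.symm) hjk.ne
  all_goals omega

lemma sub_le_of_strictAnti (hl : StrictAnti l) {b : ℤ} (hb : ∀ i, b ≤ l i) (i : Fin m) :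
    b + m - 1 - (i : ℕ) ≤ l i := by
  obtain ⟨i, hi⟩ := i
  obtain ⟨k, hk⟩ : ∃ k, i + k + 1 = m := ⟨m - i - 1, by omega⟩
  induction k generalizing i with
  | zero =>
    have := hb ⟨i, hi⟩
    simp only
    omega
  | succ k ih =>
    have h1 := ih (i + 1) (by omega) (by omega)
    have h2 : l ⟨i + 1, by omega⟩ < l ⟨i, hi⟩ := hl (Fin.mk_lt_mk.2 (Nat.lt_succ_self i))
    simp only at h1 ⊢
    push_cast at h1
    omega

/-- A partition of `n < m` has an empty last row among `m`: if all entries were positive, the sum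
would exceed that of the staircase by at least `m`. -/
lemma exists_eq_zero_of_mem_strictTuples (hl : l ∈ strictTuples m n) (hn : n < m) :
    ∃ k, l k = 0 := by
  obtain ⟨h1, h2, h3⟩ := mem_strictTuples.1 hl
  by_contra! h
  have h4 := sub_le_of_strictAnti h1 (b := 1) fun i => by
    have := h i
    have := h2 i
    omega
  have h5 : ∑ i : Fin m, (1 + m - 1 - (i : ℕ) : ℤ) ≤ ∑ i, l i := Finset.sum_le_sum fun i _ => h4 i
  have h6 : 2 * ∑ j : Fin m, ((j : ℕ) : ℤ) = m * (m - 1) :=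
    Fin.two_mul_sum_val _
  rw [Finset.sum_sub_distrib, Finset.sum_const, Finset.card_univ, Fintype.card_fin,
    nsmul_eq_mul, h3] at h5
  have h7 : (n : ℤ) < m := by exact_mod_cast hn
  nlinarith

variable (K : Type*) [Field K] [CharZero K]

/-- Lowering and raising are adjoint: both sides become sums over pairs of tuples differing by one
in one entry. -/
lemma sum_strictTuples_succ (hn : n + 1 ≤ m) :
    ((n + 1 : ℕ) : K) * ∑ l ∈ strictTuples m (n + 1), detRecip K l ^ 2 =
      ∑ l ∈ strictTuples m n, detRecip K l ^ 2 := by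
  have hl : ((n + 1 : ℕ) : K) * ∑ l ∈ strictTuples m (n + 1), detRecip K l ^ 2 =
      ∑ p ∈ strictTuples m (n + 1) ×ˢ (Finset.univ : Finset (Fin m)),
        detRecip K p.1 * detRecip K (p.1 + Pi.single p.2 (-1)) := by
    rw [Finset.sum_product, Finset.mul_sum]
    refine Finset.sum_congr rfl fun l hl => ?_
    simp only
    rw [← Finset.mul_sum, sum_detRecip_sub_single, (mem_strictTuples.1 hl).2.2]
    push_cast
    ring
  have hr : ∑ l ∈ strictTuples m n, detRecip K l ^ 2 =
      ∑ p ∈ strictTuples m n ×ˢ (Finset.univ : Finset (Fin m)),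
        detRecip K p.1 * detRecip K (p.1 + Pi.single p.2 1) := by
    rw [Finset.sum_product]
    refine Finset.sum_congr rfl fun l hl => ?_
    obtain ⟨k, hk⟩ := exists_eq_zero_of_mem_strictTuples hl (by omega)
    simp only
    rw [← Finset.mul_sum, sum_detRecip_add_single hk, sq]
  rw [hl, hr]
  have hshift : ∀ (l : Fin m → ℤ) (i : Fin m) (a : ℤ),
      l + Pi.single i a + Pi.single i (-a) = l := by
    intro l i a
    rw [add_assoc, ← Pi.single_add, add_neg_cancel, Pi.single_zero, add_zero]
  -- Only nonzero terms need matching: a shifted tuple with a repeated or negative entry has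
  -- determinant zero.
  refine Finset.sum_bij_ne_zero (fun p _ _ => (p.1 + Pi.single p.2 (-1), p.2)) ?_ ?_ ?_ ?_
  · rintro ⟨l, i⟩ hp h0
    simp only [Finset.mem_product, Finset.mem_univ, and_true] at hp ⊢
    have h1 := right_ne_zero_of_mul h0
    obtain ⟨h2, -, h3⟩ := mem_strictTuples.1 hp
    refine mem_strictTuples.2 ⟨strictAnti_add_single_of_injective h2 (by simp)
      (injective_of_detRecip_ne_zero h1), nonneg_of_detRecip_ne_zero h1, ?_⟩
    rw [sum_add_single, h3]
    push_cast
    ring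
  · rintro ⟨l, i⟩ _ _ ⟨k, j⟩ _ _ he
    simp only [Prod.mk.injEq] at he
    obtain ⟨he, rfl⟩ := he
    rw [add_right_cancel he]
  · rintro ⟨l, i⟩ hp h0
    simp only [Finset.mem_product, Finset.mem_univ, and_true] at hp
    have h1 := right_ne_zero_of_mul h0
    obtain ⟨h2, -, h3⟩ := mem_strictTuples.1 hp
    refine ⟨(l + Pi.single i 1, i), ?_, ?_, ?_⟩
    · simp only [Finset.mem_product, Finset.mem_univ, and_true]
      refine mem_strictTuples.2 ⟨strictAnti_add_single_of_injective h2 (by simp)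
        (injective_of_detRecip_ne_zero h1), nonneg_of_detRecip_ne_zero h1, ?_⟩
      rw [sum_add_single, h3]
      push_cast
      ring
    · simp only [hshift]
      rwa [mul_comm]
    · simp only [hshift]
  · rintro ⟨l, i⟩ _ _
    have := hshift l i (-1)
    rw [neg_neg] at this
    simp only [this, mul_comm]

end strictTuples

/-! ### Hook products as determinants, and the sum of their inverse squares. -/

namespace YoungDiagram

lemma colLen_zero_le_card (μ : YoungDiagram) : μ.colLen 0 ≤ μ.card := by
  rw [colLen_eq_card]
  exact Finset.card_le_card (Finset.filter_subset _ _)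

variable {m : ℕ}

/-- The bead positions of the first `m` rows, in the Maya diagram of charge `m`. -/
def beadTuple (μ : YoungDiagram) (m : ℕ) (i : Fin m) : ℤ := μ.bead i + m

lemma beadTuple_mem_strictTuples {μ : YoungDiagram} (h : μ.colLen 0 ≤ m) :
    μ.beadTuple m ∈ strictTuples m μ.card := by
  rw [mem_strictTuples]
  refine ⟨fun i j hij => ?_, fun i => ?_, ?_⟩
  · have := μ.bead_strictAnti (show (i : ℕ) < j from hij)
    unfold beadTuple
    omega
  · have := i.2
    unfold beadTuple bead
    omega
  · unfold beadTuple bead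
    rw [Fin.sum_univ_eq_sum_range (fun i : ℕ => (μ.rowLen i - i - 1 + m : ℤ)),
      Fin.sum_univ_eq_sum_range (fun i : ℕ => (i : ℤ)), μ.card_eq_sum_rowLen h,
      ← Finset.sum_range_reflect (fun i : ℕ => (i : ℤ))]
    push_cast
    rw [← Finset.sum_add_distrib]
    refine Finset.sum_congr rfl fun i hi => ?_
    have := Finset.mem_range.1 hi
    omega

lemma beadTuple_injective {μ ν : YoungDiagram} (hμ : μ.colLen 0 ≤ m) (hν : ν.colLen 0 ≤ m)
    (h : μ.beadTuple m = ν.beadTuple m) : μ = ν := by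
  refine ext_rowLen fun i => ?_
  rcases lt_or_ge i m with hi | hi
  · have := congrFun h ⟨i, hi⟩
    simp only [beadTuple, bead] at this
    omega
  · rw [(μ.rowLen_eq_zero_iff i).2 (by omega), (ν.rowLen_eq_zero_iff i).2 (by omega)]

lemma exists_beadTuple_eq {n : ℕ} {l : Fin m → ℤ} (hl : l ∈ strictTuples m n) :
    ∃ μ : YoungDiagram, μ.colLen 0 ≤ m ∧ μ.card = n ∧ μ.beadTuple m = l := by
  obtain ⟨h1, h2, h3⟩ := mem_strictTuples.1 hl
  have h4 := sub_le_of_strictAnti h1 h2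
  let r : ℕ → ℕ := fun i => if h : i < m then (l ⟨i, h⟩ - (m - 1 - i)).toNat else 0
  have hr : Antitone r := antitone_nat_of_succ_le fun i => by
    simp only [r]
    split_ifs with h h'
    · have : l ⟨i + 1, h⟩ < l ⟨i, h'⟩ := h1 (Fin.mk_lt_mk.2 (Nat.lt_succ_self i))
      push_cast
      omega
    · omega
    all_goals exact Nat.zero_le _
  have hrm : r m = 0 := by simp [r]
  obtain ⟨μ, hμ⟩ := exists_rowLen_eq r hr m hrm
  have hcol : μ.colLen 0 ≤ m := (μ.rowLen_eq_zero_iff m).1 (by rw [hμ, hrm])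
  have htuple : μ.beadTuple m = l := by
    ext ⟨i, hi⟩
    have := h4 ⟨i, hi⟩
    simp only [beadTuple, bead, hμ, r, dif_pos hi] at this ⊢
    omega
  refine ⟨μ, hcol, ?_, htuple⟩
  have h5 := (mem_strictTuples.1 (beadTuple_mem_strictTuples hcol)).2.2
  rw [htuple, h3] at h5
  omega

lemma finite_card_eq (n : ℕ) : {μ : YoungDiagram | μ.card = n}.Finite := by
  refine Set.Finite.of_injOn (f := fun μ : YoungDiagram => μ.beadTuple n)
    (t := (strictTuples n n : Set (Fin n → ℤ))) ?_ ?_ (Finset.finite_toSet _)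
  · rintro μ rfl
    exact beadTuple_mem_strictTuples μ.colLen_zero_le_card
  · rintro μ hμ ν hν h
    refine beadTuple_injective ?_ ?_ h
    · exact μ.colLen_zero_le_card.trans_eq hμ
    · exact ν.colLen_zero_le_card.trans_eq hν

lemma prod_range_sub_eq_factorial (n : ℕ) :
    ∏ x ∈ Finset.range n, ((n : ℤ) - x) = n.factorial := by
  rw [← Finset.prod_range_reflect, ← Finset.prod_range_add_one_eq_factorial]
  push_cast
  refine Finset.prod_congr rfl fun i hi => ?_
  have := Finset.mem_range.1 hi
  omega

/-- The positions from 0 to just below bead `i` are the gaps of row `i` and the later beads. Their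
distances to bead `i` are 1, …, n, with product n!; the gaps contribute the hook lengths. -/
lemma prod_row_hookLength_mul {μ : YoungDiagram} (h : μ.colLen 0 ≤ m) (i : Fin m) :
    (∏ j ∈ Finset.range (μ.rowLen i), (μ.hookLength (i, j) : ℤ)) *
      ∏ k ∈ Finset.Ioi i, (μ.beadTuple m i - μ.beadTuple m k) =
      ((μ.beadTuple m i).toNat.factorial : ℤ) := by
  have h0 : 0 ≤ μ.beadTuple m i := (mem_strictTuples.1 (beadTuple_mem_strictTuples h)).2.1 i
  obtain ⟨n, hn⟩ := Int.eq_ofNat_of_zero_le h0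
  have key : (Finset.range n).image (fun x : ℕ => (x : ℤ)) =
      (Finset.range (μ.rowLen i)).image (fun j => μ.gap j + m) ∪
        (Finset.Ioi i).image (fun k => μ.beadTuple m k) := by
    ext x
    simp only [Finset.mem_union, Finset.mem_image, Finset.mem_range, Finset.mem_Ioi]
    constructor
    · rintro ⟨x, hx, rfl⟩
      by_cases hg : ∃ j, μ.gap j + m = x
      · obtain ⟨j, hj⟩ := hg
        refine Or.inl ⟨j, ?_, hj⟩
        rw [← mem_iff_lt_rowLen, ← gap_lt_bead_iff]
        unfold beadTuple at hn
        omega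
      · rw [← notMem_maya_iff, not_not] at hg
        obtain ⟨k, hk⟩ := hg
        have hkm : k < m := by
          by_contra hkm
          have := (μ.rowLen_eq_zero_iff k).2 (by omega)
          unfold bead at hk
          omega
        refine Or.inr ⟨⟨k, hkm⟩, ?_, hk⟩
        have hlt : μ.bead k < μ.bead i := by
          unfold beadTuple at hn
          omega
        exact Fin.lt_def.2 (μ.bead_strictAnti.lt_iff_gt.1 hlt)
    · rintro (⟨j, hj, rfl⟩ | ⟨k, hk, rfl⟩)
      · have h1 := (μ.gap_lt_bead_iff i j).2 (mem_iff_lt_rowLen.2 hj)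
        have h2 := μ.colLen_anti 0 j (Nat.zero_le j)
        refine ⟨(μ.gap j + m).toNat, ?_, ?_⟩ <;>
        · unfold beadTuple gap at *
          omega
      · have h1 : μ.beadTuple m k < μ.beadTuple m i :=
          (mem_strictTuples.1 (beadTuple_mem_strictTuples h)).1 hk
        have h2 := (mem_strictTuples.1 (beadTuple_mem_strictTuples h)).2.1 k
        refine ⟨(μ.beadTuple m k).toNat, ?_, ?_⟩ <;> omega
  have hprod : ∏ x ∈ (Finset.range n).image (fun x : ℕ => (x : ℤ)), ((n : ℤ) - x) =
      n.factorial := by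
    rw [Finset.prod_image fun a _ b _ hab => by exact_mod_cast hab]
    exact prod_range_sub_eq_factorial n
  rw [key, Finset.prod_union, Finset.prod_image, Finset.prod_image] at hprod
  · rw [hn, Int.toNat_natCast, ← hprod]
    congr 1
    refine Finset.prod_congr rfl fun j hj => ?_
    rw [μ.hookLength_eq (mem_iff_lt_rowLen.2 (Finset.mem_range.1 hj)), ← hn]
    unfold beadTuple
    ring
  · intro a _ b _ hab
    exact Fin.ext (μ.bead_strictAnti.injective (add_right_cancel hab))
  · intro a _ b _ hab
    exact μ.gap_strictMono.injective (add_right_cancel hab)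
  · rw [Finset.disjoint_left]
    simp only [Finset.mem_image]
    rintro _ ⟨j, _, rfl⟩ ⟨k, _, hk⟩
    exact μ.bead_ne_gap k j (add_right_cancel hk)

lemma prod_cells_eq_prod_rows {M : Type*} [CommMonoid M] {μ : YoungDiagram}
    (h : μ.colLen 0 ≤ m) (f : ℕ × ℕ → M) :
    ∏ v ∈ μ.cells, f v = ∏ i : Fin m, ∏ j ∈ Finset.range (μ.rowLen i), f (i, j) := by
  rw [Fin.prod_univ_eq_prod_range (fun i => ∏ j ∈ Finset.range (μ.rowLen i), f (i, j)),
    ← Finset.prod_fiberwise_of_maps_to (g := Prod.fst) (t := Finset.range m)]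
  · refine Finset.prod_congr rfl fun i _ => ?_
    change ∏ v ∈ μ.row i, f v = _
    rw [row_eq_prod, Finset.prod_product, Finset.prod_singleton]
  · rintro ⟨i, j⟩ hv
    have h1 := mem_iff_lt_rowLen.1 ((mem_cells _).1 hv)
    have h2 := μ.rowLen_eq_zero_iff i
    simp only [Finset.mem_range]
    omega

lemma hookLength_pos {μ : YoungDiagram} {v : ℕ × ℕ} (hv : v ∈ μ.cells) : 0 < μ.hookLength v :=
  Finset.card_pos.2 ⟨v, Finset.mem_filter.2 ⟨hv, Or.inl rfl⟩⟩

variable (K : Type*) [Field K] [CharZero K]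

/-- Multiplying the row identities gives the hook product as ∏ l_i! over the product of differences;
squaring removes the Vandermonde sign. -/
lemma detRecip_beadTuple_sq {μ : YoungDiagram} (h : μ.colLen 0 ≤ m) :
    detRecip K (μ.beadTuple m) ^ 2 = ∏ v ∈ μ.cells, ((μ.hookLength v : K) ^ 2)⁻¹ := by
  have h0 := (mem_strictTuples.1 (beadTuple_mem_strictTuples h)).2.1
  choose l hl using fun i => Int.eq_ofNat_of_zero_le (h0 i)
  have hlfun : μ.beadTuple m = fun i => (l i : ℤ) := funext hl
  have hprod : (∏ v ∈ μ.cells, (μ.hookLength v : K)) *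
      ∏ i, ∏ k ∈ Finset.Ioi i, ((l i : K) - l k) = ∏ i, ((l i).factorial : K) := by
    rw [prod_cells_eq_prod_rows h, ← Finset.prod_mul_distrib]
    refine Finset.prod_congr rfl fun i _ => ?_
    have := prod_row_hookLength_mul h i
    simp only [hl, Int.toNat_natCast] at this
    exact_mod_cast congrArg (Int.cast : ℤ → K) this
  have hsq : (∏ i, ∏ k ∈ Finset.Ioi i, ((l k : K) - l i)) ^ 2 =
      (∏ i, ∏ k ∈ Finset.Ioi i, ((l i : K) - l k)) ^ 2 := by
    simp only [← Finset.prod_pow]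
    exact Finset.prod_congr rfl fun i _ => Finset.prod_congr rfl fun k _ => by ring
  have hfac : ∏ i, ((l i).factorial : K) ≠ 0 :=
    Finset.prod_ne_zero_iff.2 fun i _ => by exact_mod_cast (l i).factorial_ne_zero
  have hhook : ∏ v ∈ μ.cells, (μ.hookLength v : K) ≠ 0 :=
    Finset.prod_ne_zero_iff.2 fun v hv => by exact_mod_cast (hookLength_pos hv).ne'
  rw [hlfun, detRecip_natCast, mul_pow, hsq, Finset.prod_inv_distrib, Finset.prod_pow]
  rw [← hprod] at hfac ⊢
  have hd := right_ne_zero_of_mul hfac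
  field_simp

lemma sum_strictTuples_eq {n : ℕ} (h : n ≤ m) :
    ∑ l ∈ strictTuples m n, detRecip K l ^ 2 =
      ∑ μ ∈ (finite_card_eq n).toFinset, ∏ v ∈ μ.cells, ((μ.hookLength v : K) ^ 2)⁻¹ := by
  symm
  have hle : ∀ μ ∈ (finite_card_eq n).toFinset, μ.colLen 0 ≤ m := fun μ hμ => by
    have h1 : μ.card = n := (finite_card_eq n).mem_toFinset.1 hμ
    have h2 := μ.colLen_zero_le_card
    omega
  refine Finset.sum_bij (fun μ _ => μ.beadTuple m) (fun μ hμ => ?_) (fun μ hμ ν hν he => ?_)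
    (fun l hl => ?_) (fun μ hμ => ?_)
  · have h1 := beadTuple_mem_strictTuples (hle μ hμ)
    rwa [(finite_card_eq n).mem_toFinset.1 hμ] at h1
  · exact beadTuple_injective (hle μ hμ) (hle ν hν) he
  · obtain ⟨μ, _, h2, h3⟩ := exists_beadTuple_eq hl
    exact ⟨μ, (finite_card_eq n).mem_toFinset.2 h2, h3⟩
  · exact (detRecip_beadTuple_sq K (hle μ hμ)).symm

/-- The sum of the squared reciprocals of the hook products of the partitions of `n`. -/
theorem sum_prod_hookLength_sq_inv (n : ℕ) :
    ∑ μ ∈ (finite_card_eq n).toFinset, ∏ v ∈ μ.cells, ((μ.hookLength v : K) ^ 2)⁻¹ =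
      (n.factorial : K)⁻¹ := by
  induction n with
  | zero =>
    have : (finite_card_eq 0).toFinset = {⊥} := by
      ext μ
      rw [Set.Finite.mem_toFinset, Finset.mem_singleton, Set.mem_ofPred_eq]
      constructor
      · intro h
        ext v
        rw [Finset.card_eq_zero.1 h, cells_bot]
      · rintro rfl
        rfl
    rw [this, Finset.sum_singleton]
    simp
  | succ n ih =>
    -- Length `n + 1` accommodates the partitions of `n + 1` and leaves those of `n` the empty row
    -- needed for raising.
    have h := sum_strictTuples_succ K (le_refl (n + 1))
    rw [sum_strictTuples_eq K le_rfl, sum_strictTuples_eq K (Nat.le_succ n), ih] at h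
    have h1 : ((n + 1 : ℕ) : K) ≠ 0 := by exact_mod_cast n.succ_ne_zero
    rw [Nat.factorial_succ, Nat.cast_mul, mul_inv, ← h, inv_mul_cancel_left₀ h1]

end YoungDiagram

/-! ### Coefficientwise finite families of power series. -/

section coeffFinite

open PowerSeries

/-- Every coefficient is nonzero for finitely many members of the family only. -/
def CoeffFinite {ι R : Type*} [Semiring R] (f : ι → PowerSeries R) : Prop :=
  ∀ n, {i | coeff n (f i) ≠ 0}.Finite

variable {ι κ R : Type*} [CommRing R]

lemma CoeffFinite.mul {f : ι → PowerSeries R} {g : κ → PowerSeries R}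
    (hf : CoeffFinite f) (hg : CoeffFinite g) :
    CoeffFinite fun p : ι × κ => f p.1 * g p.2 := by
  intro n
  refine (Set.Finite.biUnion (Finset.HasAntidiagonal.antidiagonal n).finite_toSet
    fun q _ => (hf q.1).prod (hg q.2)).subset ?_
  rintro ⟨i, j⟩ h
  simp only [Set.mem_ofPred_eq, coeff_mul] at h
  obtain ⟨q, hq, hne⟩ := Finset.exists_ne_zero_of_sum_ne_zero h
  simp only [Set.mem_iUnion]
  exact ⟨q, hq, left_ne_zero_of_mul hne, right_ne_zero_of_mul hne⟩

lemma CoeffFinite.comp_injective {f : ι → PowerSeries R} (hf : CoeffFinite f) {e : κ → ι}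
    (he : Function.Injective e) : CoeffFinite (f ∘ e) :=
  fun n => (hf n).preimage he.injOn

lemma coeffFinite_of_finite_eq {f : ι → PowerSeries R} (φ : ι → ℕ) (a : ι → R)
    (hf : ∀ i, f i = C (a i) * X ^ φ i) (hφ : ∀ n, {i | φ i = n}.Finite) : CoeffFinite f := by
  intro n
  refine (hφ n).subset fun i hi => ?_
  by_contra h
  refine hi ?_
  rw [hf, coeff_C_mul, coeff_X_pow, if_neg fun h' => h h'.symm, mul_zero]

variable [TopologicalSpace R]

lemma CoeffFinite.summable {f : ι → PowerSeries R} (hf : CoeffFinite f) : Summable f :=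
  (WithPiTopology.summable_iff_summable_coeff R).2 fun n => summable_of_hasFiniteSupport (hf n)

lemma PowerSeries.continuous_expand {t : ℕ} (ht : t ≠ 0) :
    Continuous (expand t ht : PowerSeries R →ₐ[R] PowerSeries R) := by
  rw [continuous_iff_continuousAt]
  intro g
  refine (WithPiTopology.tendsto_iff_coeff_tendsto R _ _ _).2 fun d => ?_
  simp only [coeff_expand]
  split_ifs
  · exact (WithPiTopology.continuous_coeff R _).tendsto g
  · exact tendsto_const_nhds

variable [IsTopologicalRing R] [T2Space R]

/-- In an arbitrary topology summability of the product family is not automatic; coefficientwise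
finiteness supplies it. -/
lemma HasSum.mul_of_coeffFinite {f : ι → PowerSeries R} {g : κ → PowerSeries R}
    {s u : PowerSeries R} (hfs : HasSum f s) (hgu : HasSum g u) (hf : CoeffFinite f)
    (hg : CoeffFinite g) : HasSum (fun p : ι × κ => f p.1 * g p.2) (s * u) :=
  hfs.mul hgu (hf.mul hg).summable

lemma HasSum.pi_of_coeffFinite {f : ι → PowerSeries R} {s : PowerSeries R} (hfs : HasSum f s)
    (hf : CoeffFinite f) (t : ℕ) :
    CoeffFinite (fun ν : Fin t → ι => ∏ r, f (ν r)) ∧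
      HasSum (fun ν : Fin t → ι => ∏ r, f (ν r)) (s ^ t) := by
  induction t with
  | zero =>
    refine ⟨fun n => Set.toFinite _, ?_⟩
    simp [hasSum_unique]
  | succ t ih =>
    have he : (fun ν : Fin (t + 1) → ι => ∏ r, f (ν r)) ∘ (Fin.consEquiv fun _ => ι) =
        fun p : ι × (Fin t → ι) => f p.1 * ∏ r, f (p.2 r) := by
      ext1 p
      simp [Fin.prod_univ_succ, Fin.consEquiv]
    have h1 := hf.mul ih.1
    have h2 := hfs.mul_of_coeffFinite ih.2 hf ih.1
    rw [← he] at h1 h2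
    refine ⟨?_, ?_⟩
    · have := h1.comp_injective (Fin.consEquiv fun _ => ι).symm.injective
      rwa [Function.comp_assoc, Equiv.self_comp_symm, Function.comp_id] at this
    · rw [pow_succ']
      exact (Equiv.hasSum_iff _).1 h2

end coeffFinite

/-! ### Generating functions over partitions and over quotients. -/

namespace YoungDiagram

open PowerSeries

lemma expand_rescale_exp_pow {K : Type*} [Field K] [CharZero K] {t : ℕ} (ht : t ≠ 0) (b : K) :
    expand t ht (rescale (b / t) (exp K)) ^ t = subst (C b * X ^ t : PowerSeries K) (exp K) := by
  have ht' : (t : K) ≠ 0 := by exact_mod_cast ht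
  rw [← map_pow, ← map_pow, exp_pow_eq_rescale_exp, rescale_rescale, mul_div_cancel₀ _ ht',
    expand_apply, rescale_eq_subst,
    subst_comp_subst_apply (HasSubst.smul_X' b) (HasSubst.X_pow ht),
    subst_smul (HasSubst.X_pow ht), subst_X (HasSubst.X_pow ht), smul_eq_C_mul]

section

variable {K : Type*} [Field K] [TopologicalSpace K]

lemma hasSum_C_mul_X_pow_card (w : YoungDiagram → K) :
    HasSum (fun μ : YoungDiagram => C (w μ) * (X : PowerSeries K) ^ μ.card)
      (PowerSeries.mk fun n => ∑ μ ∈ (finite_card_eq n).toFinset, w μ) := by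
  rw [WithPiTopology.hasSum_iff_hasSum_coeff]
  intro n
  have h : ∀ μ : YoungDiagram, μ ∉ (finite_card_eq n).toFinset →
      coeff n (C (w μ) * (X : PowerSeries K) ^ μ.card) = 0 := fun μ hμ => by
    rw [coeff_C_mul, coeff_X_pow, if_neg fun h => hμ ((finite_card_eq n).mem_toFinset.2 h.symm),
      mul_zero]
  have h1 := hasSum_sum_of_ne_finset_zero h (L := .unconditional _)
  rw [coeff_mk]
  convert h1 using 1
  refine Finset.sum_congr rfl fun μ hμ => ?_
  have hn : μ.card = n := (finite_card_eq n).mem_toFinset.1 hμ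
  rw [coeff_C_mul, coeff_X_pow, if_pos hn.symm, mul_one]

lemma card_finite_card_eq (n : ℕ) :
    (finite_card_eq n).toFinset.card = Fintype.card (Nat.Partition n) := by
  rw [← Finset.card_univ]
  have hsum : ∀ μ : YoungDiagram, (μ.rowLens : Multiset ℕ).sum = μ.card := fun μ => by
    rw [rowLens, μ.card_eq_sum_rowLen le_rfl]
    rfl
  refine Finset.card_bij (fun μ hμ => ⟨μ.rowLens, fun {i} hi => μ.pos_of_mem_rowLens i hi,
    (hsum μ).trans ((finite_card_eq n).mem_toFinset.1 hμ)⟩) (fun _ _ => Finset.mem_univ _)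
    (fun μ _ ν _ h => ?_) (fun p _ => ?_)
  · have h1 : (μ.rowLens : Multiset ℕ) = ν.rowLens := congrArg Nat.Partition.parts h
    have h2 := (Multiset.coe_eq_coe.1 h1).eq_of_sortedGE μ.rowLens_sorted ν.rowLens_sorted
    exact equivListRowLens.injective (Subtype.ext h2)
  · have hs : (p.parts.sort (· ≥ ·)).SortedGE :=
      List.sortedGE_iff_pairwise.2 (p.parts.pairwise_sort _)
    have hpos : ∀ x ∈ p.parts.sort (· ≥ ·), 0 < x := fun x hx =>
      p.parts_pos ((Multiset.mem_sort _).1 hx)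
    have h1 := rowLens_ofRowLens_eq_self (hw := hs) hpos
    have h2 : ((ofRowLens _ hs).rowLens : Multiset ℕ) = p.parts := by
      rw [h1, Multiset.sort_eq]
    refine ⟨ofRowLens _ hs, ?_, Nat.Partition.ext h2⟩
    rw [(finite_card_eq n).mem_toFinset]
    change (ofRowLens _ hs).card = n
    rw [← hsum, h2, p.parts_sum]

lemma hasSum_prod_hookLength [CharZero K] (β : K) :
    HasSum (fun μ : YoungDiagram =>
        C (∏ v ∈ μ.cells, β * ((μ.hookLength v : K) ^ 2)⁻¹) * (X : PowerSeries K) ^ μ.card)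
      (rescale β (exp K)) := by
  convert hasSum_C_mul_X_pow_card fun μ : YoungDiagram =>
    ∏ v ∈ μ.cells, β * ((μ.hookLength v : K) ^ 2)⁻¹ using 1
  ext n
  rw [coeff_rescale, coeff_exp, coeff_mk]
  have h : ∀ μ ∈ (finite_card_eq n).toFinset,
      ∏ v ∈ μ.cells, β * ((μ.hookLength v : K) ^ 2)⁻¹ =
        β ^ n * ∏ v ∈ μ.cells, ((μ.hookLength v : K) ^ 2)⁻¹ := fun μ hμ => by
    have hn : μ.cells.card = n := (finite_card_eq n).mem_toFinset.1 hμ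
    rw [Finset.prod_mul_distrib, Finset.prod_const, hn]
  rw [Finset.sum_congr rfl h, ← Finset.mul_sum, sum_prod_hookLength_sq_inv]
  simp

end

variable {K : Type*} [Field K] [TopologicalSpace K] [IsTopologicalRing K] [T2Space K]

lemma hasProd_inv_one_sub_X_pow :
    HasProd (fun k : ℕ => (1 - (X : PowerSeries K) ^ (k + 1))⁻¹)
      (PowerSeries.mk fun n => ∑ _μ ∈ (finite_card_eq n).toFinset, (1 : K)) := by
  have hterm : ∀ i : ℕ, (1 - (X : PowerSeries K) ^ (i + 1))⁻¹ =
      1 + ∑' j : ℕ, (1 : K) • (X : PowerSeries K) ^ ((i + 1) * (j + 1)) := fun i => by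
    have hc : constantCoeff ((X : PowerSeries K) ^ (i + 1)) = 0 := by simp
    have h1 := WithPiTopology.one_sub_mul_tsum_pow_of_constantCoeff_eq_zero hc
    have h2 := WithPiTopology.summable_pow_of_constantCoeff_eq_zero hc
    rw [h2.tsum_eq_zero_add, mul_comm] at h1
    rw [eq_comm, PowerSeries.eq_inv_iff_mul_eq_one (by simp)]
    simpa only [one_smul, pow_mul, pow_zero] using h1
  have hgen : (PowerSeries.mk fun n => ∑ _μ ∈ (finite_card_eq n).toFinset, (1 : K)) =
      Nat.Partition.genFun fun _ _ => 1 := by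
    ext n
    rw [coeff_mk, Nat.Partition.coeff_genFun]
    simp [card_finite_card_eq, Finsupp.prod]
  simp only [hterm, hgen]
  exact Nat.Partition.hasProd_genFun fun _ _ => 1

/-- The generating function of the partitions, weighted multiplicatively along the
`t`-quotient. -/
lemma exists_hasSum_core {t : ℕ} (ht : t ≠ 0) :
    ∃ R : PowerSeries K, ∀ (W w : YoungDiagram → K) (S : PowerSeries K),
      (∀ (μ : YoungDiagram) (ν : Fin t → YoungDiagram) (c : Fin t → ℤ),
        IsQuotient μ 0 ν c → W μ = ∏ r, w (ν r)) →
      HasSum (fun μ : YoungDiagram => C (w μ) * (X : PowerSeries K) ^ μ.card) S →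
      HasSum (fun μ : YoungDiagram => C (W μ) * (X : PowerSeries K) ^ μ.card)
        (R * expand t ht S ^ t) := by
  have ht' := Nat.pos_of_ne_zero ht
  obtain ⟨e, he⟩ := exists_quotientEquiv ht'
  -- The size of the t-core with charges `c`, which is the partition with empty quotient.
  let Q : {c : Fin t → ℤ // ∑ r, c r = 0} → ℕ := fun c => (e (c, fun _ => ⊥)).card
  have hcard : ∀ p, (e p).card = Q p.1 + t * ∑ r, (p.2 r).card := by
    rintro ⟨c, ν⟩
    have h1 := (he (c, ν)).two_mul_card ht'
    have h2 := (he (c, fun _ => ⊥)).two_mul_card ht'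
    have h3 : (⊥ : YoungDiagram).card = 0 := rfl
    simp only [h3, Nat.cast_zero, Finset.sum_const_zero, mul_zero, zero_add] at h1 h2
    zify
    simp only [Q]
    linarith
  have hQ : CoeffFinite fun c => (X : PowerSeries K) ^ Q c := by
    refine coeffFinite_of_finite_eq Q (fun _ => 1) (fun c => by simp) fun n => ?_
    have hinj : Function.Injective fun c => e (c, fun _ => ⊥) := fun c d h => by
      simpa using e.injective h
    exact (finite_card_eq n).preimage hinj.injOn
  -- The core series is fixed before the weights, so trivial weights can later determine it.
  refine ⟨∑' c, X ^ Q c, fun W w S hW hS => ?_⟩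
  let f : YoungDiagram → PowerSeries K := fun μ => C (w μ) * X ^ (t * μ.card)
  have hf : CoeffFinite f := by
    refine coeffFinite_of_finite_eq (fun μ => t * μ.card) w (fun _ => rfl) fun n => ?_
    refine (finite_card_eq (n / t)).subset fun μ hμ => ?_
    rw [Set.mem_ofPred_eq] at hμ ⊢
    rw [← hμ, Nat.mul_div_cancel_left _ ht']
  have hfS : HasSum f (expand t ht S) := by
    have h := hS.map (expand t ht) (continuous_expand ht)
    convert h using 1
    ext1 μ
    simp [f, expand_C, expand_X, pow_mul]
  have hpi := hfS.pi_of_coeffFinite hf t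
  have h := hQ.summable.hasSum.mul_of_coeffFinite hpi.2 hQ hpi.1
  rw [← e.hasSum_iff]
  convert h using 1
  ext1 p
  simp only [Function.comp_apply, f]
  rw [hW _ _ _ (he p), hcard, Finset.prod_mul_distrib, Finset.prod_pow_eq_pow_sum,
    ← Finset.mul_sum, map_prod, pow_add]
  ring

lemma prod_map_hookLengthsDvd {M : Type*} [CommMonoid M] (t : ℕ) (μ : YoungDiagram)
    (f : ℕ → M) :
    ((μ.hookLengthsDvd t).map f).prod =
      ∏ v ∈ μ.cells with t ∣ μ.hookLength v, f (μ.hookLength v) := by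
  simp only [hookLengthsDvd, hookLengths, Multiset.filter_map, Multiset.map_map]
  rfl

end YoungDiagram

theorem corollary5p4 (K : Type*) [Field K] [CharZero K]
    [TopologicalSpace K] [IsTopologicalRing K] [T2Space K]
    (t : ℕ) (ht : 0 < t) (b : K) :
    Multipliable (fun k : ℕ =>
      (1 - (PowerSeries.X : PowerSeries K) ^ (t * (k + 1))) ^ t *
        (1 - (PowerSeries.X : PowerSeries K) ^ (k + 1))⁻¹) ∧
    HasSum
      (fun μ : YoungDiagram =>
        PowerSeries.C ((μ.hookLengthsDvd t).map fun h : ℕ => (t : K) * b / (h : K) ^ 2).prod *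
          (PowerSeries.X : PowerSeries K) ^ μ.card)
      (PowerSeries.subst (PowerSeries.C b * PowerSeries.X ^ t : PowerSeries K)
          (PowerSeries.exp K) *
        ∏' k : ℕ,
          (1 - (PowerSeries.X : PowerSeries K) ^ (t * (k + 1))) ^ t *
            (1 - (PowerSeries.X : PowerSeries K) ^ (k + 1))⁻¹) := by
  have ht0 : t ≠ 0 := ht.ne'
  set P : PowerSeries K :=
    PowerSeries.mk fun n => ∑ _μ ∈ (YoungDiagram.finite_card_eq n).toFinset, (1 : K)
  have hprodP := YoungDiagram.hasProd_inv_one_sub_X_pow (K := K)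
  have hprodZ := (PowerSeries.WithPiTopology.multipliable_one_sub_X_pow K).hasProd
  set Z : PowerSeries K := ∏' k : ℕ, (1 - (PowerSeries.X : PowerSeries K) ^ (k + 1))
  have hZP : Z * P = 1 := by
    refine (hprodZ.mul hprodP).unique ?_
    convert hasProd_one using 1
    ext1 k
    exact PowerSeries.mul_inv_cancel _ (by simp)
  have hprodZt : HasProd (fun k : ℕ => 1 - (PowerSeries.X : PowerSeries K) ^ (t * (k + 1)))
      (PowerSeries.expand t ht0 Z) := by
    convert hprodZ.map (PowerSeries.expand t ht0) (PowerSeries.continuous_expand ht0) using 1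
    ext1 k
    simp [PowerSeries.expand_X, pow_mul]
  have hprod := (hprodZt.pow t).mul hprodP
  refine ⟨hprod.multipliable, ?_⟩
  rw [hprod.tprod_eq]
  obtain ⟨R, hR⟩ := YoungDiagram.exists_hasSum_core (K := K) ht0
  -- Trivial weights give P(x) = R(x) P(x^t)^t; with `Z * P = 1` this solves for `R` without an
  -- explicit sum over cores.
  have hone := hR (fun _ => 1) (fun _ => 1) P (fun _ _ _ _ => by simp)
    (YoungDiagram.hasSum_C_mul_X_pow_card fun _ => 1)
  have hPR : P = R * PowerSeries.expand t ht0 P ^ t :=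
    (YoungDiagram.hasSum_C_mul_X_pow_card fun _ => 1).unique hone
  have hRP : R = PowerSeries.expand t ht0 Z ^ t * P := by
    calc R = R * PowerSeries.expand t ht0 (Z * P) ^ t := by rw [hZP, map_one, one_pow, mul_one]
      _ = PowerSeries.expand t ht0 Z ^ t * (R * PowerSeries.expand t ht0 P ^ t) := by
        rw [map_mul, mul_pow]
        ring
      _ = PowerSeries.expand t ht0 Z ^ t * P := by rw [← hPR]
  have hmain := hR
    (fun μ => ((μ.hookLengthsDvd t).map fun h : ℕ => (t : K) * b / (h : K) ^ 2).prod)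
    -- A quotient hook length `h` enters as `t * h`, and tb/(th)^2 = (b/t)/h^2.
    (fun μ => ∏ v ∈ μ.cells, b / t * ((μ.hookLength v : K) ^ 2)⁻¹) _ (fun μ ν c h => by
      rw [YoungDiagram.prod_map_hookLengthsDvd,
        h.prod_hookLength ht fun n : ℕ => (t : K) * b / (n : K) ^ 2]
      refine Finset.prod_congr rfl fun r _ => Finset.prod_congr rfl fun v hv => ?_
      have hne : ((ν r).hookLength v : K) ≠ 0 := by
        exact_mod_cast (YoungDiagram.hookLength_pos hv).ne'
      push_cast
      field_simp)
    (YoungDiagram.hasSum_prod_hookLength (b / t))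
  rwa [YoungDiagram.expand_rescale_exp_pow, hRP, mul_comm (_ * P)] at hmain
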